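/- All graphs are finite, simple and undirected, and first-order sentences about graphs are built from adjacency and equality of vertices. For a connected graph $F$ let $v(F)$ be its number of vertices, and let $D_v(F)$ be the minimum quantifier depth of a first-order sentence $\Phi$ for which there is an integer $k$ such that, for every connected graph $G$ with at least $k$ vertices, $\Phi$ is true on $G$ if and only if $G$ contains a (not necessarily induced) subgraph isomorphic to $F$. The sparkler graph $S_{4,4}$ is obtained from the disjoint union of the star $K_{1,3}$ and the path $P_4$ on $4$ vertices by adding an edge between the central vertex of the star and an end vertex of the path. **Theorem.** There is a connected graph $F$ with $D_v(F)\le v(F)-3$. Specifically, $S_{4,4}$ is a connected graph with $8$ vertices and $D_v(S_{4,4})=5$. -/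

import Mathlib

open FirstOrder

namespace GraphFO

/-- The quantifier depth (maximum number of nested quantifiers) of a first-order formula.
In Mathlib's syntax `¬`, `∧`, `∨`, `↔` abbreviate formulas built from `falsum` and `imp`,
and `∃` abbreviates `¬∀¬`, so those connectives also have their usual effect on the depth. -/
def quantifierDepth {L : Language} {α : Type} : {n : ℕ} → L.BoundedFormula α n → ℕ
  | _, .falsum => 0
  | _, .equal _ _ => 0
  | _, .rel _ _ => 0
  | _, .imp φ ψ => max (quantifierDepth φ) (quantifierDepth ψ)
  | _, .all φ => quantifierDepth φ + 1

/-- `G ⊨ φ` for a first-order sentence in the language of adjacency and equality. -/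
def Satisfies {V : Type} (G : SimpleGraph V) (φ : Language.graph.Sentence) : Prop :=
  @Language.Sentence.Realize Language.graph V G.structure φ

/-- A class of graphs, given by its membership predicate. -/
abbrev GraphClass : Type 1 := ∀ ⦃V : Type⦄, SimpleGraph V → Prop

/-- The class of all graphs that contain a (not necessarily induced) subgraph isomorphic
to `F`. -/
def subgraphClass {W : Type} (F : SimpleGraph W) : GraphClass :=
  fun _ G => F.IsContained G

/-- `φ` defines the class `C` on connected finite graphs with at least `k` vertices. -/
def DefinesFrom (C : GraphClass) (k : ℕ) (φ : Language.graph.Sentence) : Prop :=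
  ∀ (V : Type) [Finite V] (G : SimpleGraph V),
    G.Connected → k ≤ Nat.card V → (Satisfies G φ ↔ C G)

/-- `D_v^k(C)`: the minimum quantifier depth of a first-order sentence defining `C` on
connected graphs with at least `k` vertices (`⊤` if there is no such sentence). -/
noncomputable def depthFrom (C : GraphClass) (k : ℕ) : ℕ∞ :=
  ⨅ (φ : Language.graph.Sentence) (_ : DefinesFrom C k φ), (quantifierDepth φ : ℕ∞)

/-- `D_v(C) = min_k D_v^k(C)`. -/
noncomputable def depthLarge (C : GraphClass) : ℕ∞ :=
  ⨅ k : ℕ, depthFrom C k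

/-- `D_v(F) = D_v(SUB(F))`: the minimum quantifier depth of a first-order sentence that defines
containment of `F` as a subgraph on sufficiently large connected graphs. -/
noncomputable def Dv {W : Type} (F : SimpleGraph W) : ℕ∞ :=
  depthLarge (subgraphClass F)

/-- The sparkler graph `S_{a,b}`: the disjoint union of the star `K_{1,a-1}` (with centre `0`)
and the path `P_b` on `b` vertices, together with an edge joining the centre of the star and
an end vertex of the path. -/
def sparkler (a b : ℕ) [NeZero a] [NeZero b] : SimpleGraph (Fin a ⊕ Fin b) :=
  (SimpleGraph.starGraph (0 : Fin a)).sum (SimpleGraph.pathGraph b) ⊔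
    SimpleGraph.edge (Sum.inl 0) (Sum.inr 0)

end GraphFO

/-!
The value `5` is an upper bound because a sentence of depth five defines containment of the sparkler
`S_{4,4}` on connected graphs with at least 344 vertices, and a lower bound because two arbitrarily
large connected graphs, only one of which contains it, agree on all sentences of depth four.

**Upper bound.** Depth five allows saying that a vertex `x` has four neighbours, or that it starts a
path `x p₁ p₂ p₃ p₄`, but not both with disjoint witnesses. In a large connected graph this is nearly
enough. If some vertex is at distance at least four from a vertex `x` of degree at least four, a
geodesic and three further neighbours of `x` form a sparkler. Otherwise the graph has bounded radius,
so some vertex `y` has degree at least seven, and any path with four edges from `y` completes to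
a sparkler centred at `y`. Following how `y` is attached to the path `x p₁ p₂ p₃ p₄`, one always finds
a sparkler, with one exception: `y = p₂` is adjacent to `x`, and `x` has degree exactly four
(`sparkler_isContained_of_isPathFour_of_seven_le_degree`). Hence it is enough to require in addition
that `x ≁ p₂` or that `x` has degree at least five. The latter seems to need six variables. But if `x`
has a neighbour `y` adjacent to some, but not all, of its other neighbours, then four neighbours
other than `y` can be counted by two blocks of three, which differ in how many of their members are
adjacent to `y` (`NeighborsSplit`). If there is no such `y`, then among any five neighbours including
`p₁ ∼ p₂` all are adjacent, and there is a clique of size five, which also forces a sparkler in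
a large connected graph. This gives `SparklerCriterion`.

**Lower bound.** In the tree with edges `01`, `12`, `23`, `34`, `25` replace the vertex `1` by `m` twins
and the vertex `5` by many twins. For `m = 4` the vertex `0` is the centre of a sparkler, while for `m = 3`
the only vertex of degree at least four is the copy of `2`, which starts no path with four edges.
Duplicator wins the four-round Ehrenfeucht–Fraïssé game by answering with a twin
(`GoodPosition.forth`). This fails only if Spoiler selects four copies of `1`, and then the last answer
can be a copy of `5`: it is as little adjacent to the first three vertices as a copy of `1` would be.
-/

namespace GraphFO

open Language BoundedFormula

/-! ### The sparkler graph -/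

/-- `v - a - b - c - d` is a path with four edges in `G`. -/
def IsPathFour {V : Type} (G : SimpleGraph V) (v a b c d : V) : Prop :=
  G.Adj v a ∧ G.Adj a b ∧ G.Adj b c ∧ G.Adj c d ∧ [v, a, b, c, d].Nodup

theorem isPathFour_iff {V : Type} {G : SimpleGraph V} {v a b c d : V} :
    IsPathFour G v a b c d ↔ (G.Adj v a ∧ G.Adj a b ∧ G.Adj b c ∧ G.Adj c d) ∧
      v ≠ b ∧ v ≠ c ∧ v ≠ d ∧ a ≠ c ∧ a ≠ d ∧ b ≠ d := by
  have hne := @SimpleGraph.Adj.ne _ G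
  simp only [IsPathFour, List.nodup_cons, List.mem_cons, List.not_mem_nil, or_false, not_or,
    not_false_eq_true, List.nodup_nil, and_true]
  constructor
  · tauto
  · rintro ⟨⟨h1, h2, h3, h4⟩, h⟩
    have := hne h1
    have := hne h2
    have := hne h3
    have := hne h4
    tauto

theorem sparkler_isContained_iff {V : Type} (G : SimpleGraph V) :
    (sparkler 4 4).IsContained G ↔ ∃ x p₁ p₂ p₃ p₄, IsPathFour G x p₁ p₂ p₃ p₄ ∧
      ∃ z₁ z₂ z₃, G.Adj x z₁ ∧ G.Adj x z₂ ∧ G.Adj x z₃ ∧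
        [z₁, z₂, z₃, p₁, p₂, p₃, p₄].Nodup := by
  constructor
  · rintro ⟨f⟩
    have hinj := f.injective
    have hadj : ∀ a b, (sparkler 4 4).Adj a b → G.Adj (f a) (f b) := fun a b h => f.toHom.map_adj h
    refine ⟨f (.inl 0), f (.inr 0), f (.inr 1), f (.inr 2), f (.inr 3), ⟨?_, ?_, ?_, ?_, ?_⟩,
      f (.inl 1), f (.inl 2), f (.inl 3), ?_, ?_, ?_, ?_⟩
    any_goals
      apply hadj
      simp [sparkler, SimpleGraph.edge_adj, SimpleGraph.starGraph_adj, SimpleGraph.pathGraph_adj]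
    · exact List.Nodup.map hinj
        (l := [.inl 0, .inr 0, .inr 1, .inr 2, .inr 3]) (by decide)
    · exact List.Nodup.map hinj
        (l := [.inl 1, .inl 2, .inl 3, .inr 0, .inr 1, .inr 2, .inr 3]) (by decide)
  · rintro ⟨x, p₁, p₂, p₃, p₄, ⟨h1, h2, h3, h4, hp⟩, z₁, z₂, z₃, g1, g2, g3, hz⟩
    have n1 := g1.ne
    have n2 := g2.ne
    have n3 := g3.ne
    simp only [List.nodup_cons, List.mem_cons, List.not_mem_nil, or_false, not_or,
      not_false_eq_true, List.nodup_nil, and_true] at hp hz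
    refine ⟨⟨⟨Sum.elim ![x, z₁, z₂, z₃] ![p₁, p₂, p₃, p₄], ?_⟩, ?_⟩⟩
    · rintro (a | a) (b | b) hab <;> fin_cases a <;> fin_cases b <;>
        simp [sparkler, SimpleGraph.edge_adj, SimpleGraph.starGraph_adj,
          SimpleGraph.pathGraph_adj] at hab ⊢ <;>
        first | assumption | (apply SimpleGraph.Adj.symm; assumption)
    · have key : ∀ a b : Fin 4 ⊕ Fin 4, a ≠ b → Sum.elim ![x, z₁, z₂, z₃] ![p₁, p₂, p₃, p₄] a ≠
          Sum.elim ![x, z₁, z₂, z₃] ![p₁, p₂, p₃, p₄] b := by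
        rintro (a | a) (b | b) hab <;> fin_cases a <;> fin_cases b <;>
          simp at hab ⊢ <;> grind
      intro a b hab
      by_contra h
      exact key a b h hab

theorem sparkler_connected : (sparkler 4 4).Connected := by
  have hadj : ∀ a b, (sparkler 4 4).Adj a b → (sparkler 4 4).Reachable a b :=
    fun a b h => h.reachable
  have star : ∀ i : Fin 4, (sparkler 4 4).Reachable (.inl 0) (.inl i) := by
    intro i
    by_cases hi : i = 0
    · rw [hi]
    · apply hadj
      simp [sparkler, SimpleGraph.starGraph_adj, Ne.symm hi]
  have step : (sparkler 4 4).Reachable (.inl 0) (.inr 0) := by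
    apply hadj
    simp [sparkler, SimpleGraph.edge_adj]
  have path : ∀ i : Fin 4, (sparkler 4 4).Reachable (.inr 0) (.inr i) := by
    intro i
    have h := SimpleGraph.pathGraph_connected 3 |>.preconnected 0 i
    let g : SimpleGraph.pathGraph 4 →g sparkler 4 4 :=
      ⟨Sum.inr, fun {a b} hab => Or.inl (SimpleGraph.sum_adj_inr.2 hab)⟩
    exact h.map g
  rw [SimpleGraph.connected_iff_exists_forall_reachable]
  refine ⟨.inl 0, ?_⟩
  rintro (i | i)
  · exact star i
  · exact step.trans (path i)

/-! ### The defining sentence -/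

/-- The atomic formula `xᵢ ∼ xⱼ`. -/
def adjF {n : ℕ} (i j : Fin n) : Language.graph.BoundedFormula Empty n :=
  Language.adj.boundedFormula₂ (&i) (&j)

/-- The atomic formula `xᵢ = xⱼ`. -/
def eqF {n : ℕ} (i j : Fin n) : Language.graph.BoundedFormula Empty n :=
  .equal (&i) (&j)

/-- The variables listed in `l` are pairwise distinct. -/
def distinctF {n : ℕ} : List (Fin n) → Language.graph.BoundedFormula Empty n
  | [] => ⊤
  | i :: l => (l.foldr (fun j φ => (eqF i j).not ⊓ φ) ⊤) ⊓ distinctF l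

section realize

variable {V : Type} (G : SimpleGraph V) {n : ℕ} (v : Empty → V) (xs : Fin n → V)

theorem realize_adjF (i j : Fin n) :
    @BoundedFormula.Realize _ V G.structure _ _ (adjF i j) v xs ↔ G.Adj (xs i) (xs j) := by
  let := G.structure
  rw [adjF, realize_rel₂]
  rfl

theorem realize_eqF (i j : Fin n) :
    @BoundedFormula.Realize _ V G.structure _ _ (eqF i j) v xs ↔ xs i = xs j := by
  let := G.structure
  exact Iff.rfl

theorem realize_distinctF (l : List (Fin n)) :
    @BoundedFormula.Realize _ V G.structure _ _ (distinctF l) v xs ↔ (l.map xs).Nodup := by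
  let := G.structure
  induction l with
  | nil => simp [distinctF]
  | cons i l ih =>
    have key : ∀ l' : List (Fin n), BoundedFormula.Realize
        (l'.foldr (fun j φ => (eqF i j).not ⊓ φ) ⊤) v xs ↔ xs i ∉ l'.map xs := by
      intro l'
      induction l' with
      | nil => simp
      | cons j l' ih' =>
        rw [List.foldr_cons, realize_inf, ih', realize_not, realize_eqF]
        simp
    exact realize_inf.trans ((and_congr (key l) ih).trans List.nodup_cons.symm)

end realize

/-- The formula `φ` or its negation, according to the value of `b`. -/
def litF {n : ℕ} (b : Bool) (φ : Language.graph.BoundedFormula Empty n) :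
    Language.graph.BoundedFormula Empty n :=
  cond b φ φ.not

theorem realize_litF {V : Type} (G : SimpleGraph V) {n : ℕ} (v : Empty → V) (xs : Fin n → V)
    (b : Bool) (φ : Language.graph.BoundedFormula Empty n) :
    @BoundedFormula.Realize _ V G.structure _ _ (litF b φ) v xs ↔
      (@BoundedFormula.Realize _ V G.structure _ _ φ v xs ↔ b = true) := by
  let := G.structure
  cases b <;> simp [litF]

/-- `x` has three neighbours other than `y`, whose adjacencies to `y` are prescribed by the
truth values `b₁`, `b₂`, `b₃`. -/
def NeighborsSplit {V : Type} (G : SimpleGraph V) (x y : V) (b₁ b₂ b₃ : Bool) : Prop :=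
  ∃ u₁ u₂ u₃, G.Adj x u₁ ∧ G.Adj x u₂ ∧ G.Adj x u₃ ∧ [y, u₁, u₂, u₃].Nodup ∧
    (G.Adj y u₁ ↔ b₁ = true) ∧ (G.Adj y u₂ ↔ b₂ = true) ∧ (G.Adj y u₃ ↔ b₃ = true)

/-- The property of graphs expressed by the sentence of quantifier depth five. -/
def SparklerCriterion {V : Type} (G : SimpleGraph V) : Prop :=
  (∃ x, (∃ a b c d, G.Adj x a ∧ G.Adj x b ∧ G.Adj x c ∧ G.Adj x d ∧ [a, b, c, d].Nodup) ∧
    ∃ p₁ p₂ p₃ p₄, IsPathFour G x p₁ p₂ p₃ p₄ ∧ ¬ G.Adj x p₂) ∨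
  (∃ x, (∃ p₁ p₂ p₃ p₄, IsPathFour G x p₁ p₂ p₃ p₄) ∧ ∃ y, G.Adj x y ∧
    ((NeighborsSplit G x y false false false ∧ NeighborsSplit G x y true false false) ∨
     (NeighborsSplit G x y true false false ∧ NeighborsSplit G x y true true false) ∨
     (NeighborsSplit G x y true true false ∧ NeighborsSplit G x y true true true))) ∨
  ∃ a b c d e, G.Adj a b ∧ G.Adj a c ∧ G.Adj a d ∧ G.Adj a e ∧ G.Adj b c ∧ G.Adj b d ∧
    G.Adj b e ∧ G.Adj c d ∧ G.Adj c e ∧ G.Adj d e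

/-- `x₀` has at least four neighbours. -/
def degreeFourF : Language.graph.BoundedFormula Empty 1 :=
  ∃' ∃' ∃' ∃' (adjF (n := 5) 0 1 ⊓ (adjF 0 2 ⊓ (adjF 0 3 ⊓ (adjF 0 4 ⊓
    distinctF [1, 2, 3, 4]))))

/-- `x₀ - x₁ - x₂ - x₃ - x₄` is a path. -/
def pathF : Language.graph.BoundedFormula Empty 5 :=
  adjF 0 1 ⊓ (adjF 1 2 ⊓ (adjF 2 3 ⊓ (adjF 3 4 ⊓ distinctF [0, 1, 2, 3, 4])))

/-- `NeighborsSplit` for `x₀` and `x₁`. -/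
def splitF (b₁ b₂ b₃ : Bool) : Language.graph.BoundedFormula Empty 2 :=
  ∃' ∃' ∃' (adjF (n := 5) 0 2 ⊓ (adjF 0 3 ⊓ (adjF 0 4 ⊓ (distinctF [1, 2, 3, 4] ⊓
    (litF b₁ (adjF 1 2) ⊓ (litF b₂ (adjF 1 3) ⊓ litF b₃ (adjF 1 4)))))))

/-- The variables `x₀, …, x₄` form a clique. -/
def cliqueF : Language.graph.BoundedFormula Empty 5 :=
  adjF 0 1 ⊓ (adjF 0 2 ⊓ (adjF 0 3 ⊓ (adjF 0 4 ⊓ (adjF 1 2 ⊓ (adjF 1 3 ⊓ (adjF 1 4 ⊓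
    (adjF 2 3 ⊓ (adjF 2 4 ⊓ adjF 3 4))))))))

/-- The sentence of quantifier depth five that expresses `SparklerCriterion`. -/
def sparklerSentence : Language.graph.Sentence :=
  ((∃' (degreeFourF ⊓ ∃' ∃' ∃' ∃' (pathF ⊓ (adjF 0 2).not))) ⊔
   ((∃' ((∃' ∃' ∃' ∃' pathF) ⊓ ∃' (adjF 0 1 ⊓
      ((splitF false false false ⊓ splitF true false false) ⊔
      ((splitF true false false ⊓ splitF true true false) ⊔
       (splitF true true false ⊓ splitF true true true)))))) ⊔
    (∃' ∃' ∃' ∃' ∃' cliqueF)) : Language.graph.BoundedFormula Empty 0)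

set_option maxRecDepth 20000 in
theorem quantifierDepth_sparklerSentence : quantifierDepth sparklerSentence = 5 :=
  rfl

theorem realize_splitF {V : Type} (G : SimpleGraph V) (v : Empty → V) (xs : Fin 2 → V)
    (b₁ b₂ b₃ : Bool) :
    @BoundedFormula.Realize _ V G.structure _ _ (splitF b₁ b₂ b₃) v xs ↔
      NeighborsSplit G (xs 0) (xs 1) b₁ b₂ b₃ := by
  let := G.structure
  simp only [splitF, realize_ex, realize_inf, realize_adjF, realize_distinctF, realize_litF]
  rfl

theorem satisfies_sparklerSentence {V : Type} (G : SimpleGraph V) :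
    Satisfies G sparklerSentence ↔ SparklerCriterion G := by
  let := G.structure
  unfold Satisfies Sentence.Realize Formula.Realize
  simp only [sparklerSentence, degreeFourF, pathF, cliqueF, realize_sup, realize_ex,
    realize_inf, realize_not, realize_adjF, realize_distinctF, realize_splitF]
  rfl

/-! ### Graphs containing the sparkler satisfy the criterion -/

section Graphs

variable {V : Type} {G : SimpleGraph V}

/-- If a neighbour `y` of `x` is adjacent to some but not all of four other neighbours of `x`, then
among them there are triples with `j` and with `j + 1` neighbours of `y`, for some `j`. -/
theorem neighborsSplit_of_not_homogeneous {x y a b c d : V}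
    (ha : G.Adj x a) (hb : G.Adj x b) (hc : G.Adj x c) (hd : G.Adj x d)
    (hn : [y, a, b, c, d].Nodup) (hya : G.Adj y a) (hyb : ¬ G.Adj y b) :
    (NeighborsSplit G x y false false false ∧ NeighborsSplit G x y true false false) ∨
    (NeighborsSplit G x y true false false ∧ NeighborsSplit G x y true true false) ∨
    (NeighborsSplit G x y true true false ∧ NeighborsSplit G x y true true true) := by
  simp only [List.nodup_cons, List.mem_cons, List.not_mem_nil, or_false, not_or,
    not_false_eq_true, List.nodup_nil, and_true] at hn
  by_cases hyc : G.Adj y c <;> by_cases hyd : G.Adj y d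
  · exact .inr (.inr ⟨⟨a, c, b, by grind⟩, ⟨a, c, d, by grind⟩⟩)
  · exact .inr (.inl ⟨⟨a, b, d, by grind⟩, ⟨a, c, b, by grind⟩⟩)
  · exact .inr (.inl ⟨⟨a, b, c, by grind⟩, ⟨a, d, b, by grind⟩⟩)
  · exact .inl ⟨⟨b, c, d, by grind⟩, ⟨a, c, d, by grind⟩⟩

/-- Containing the sparkler implies the criterion, in every graph. If the second vertex `p₂` of
the tail is adjacent to the centre, then the centre has five neighbours `p₁, p₂, z₁, z₂, z₃`;
either one of them is adjacent to some but not all of the others, or, since `p₁ ∼ p₂`, they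
form a clique. -/
theorem sparklerCriterion_of_isContained (h : (sparkler 4 4).IsContained G) :
    SparklerCriterion G := by
  obtain ⟨x, p₁, p₂, p₃, p₄, hp, z₁, z₂, z₃, h1, h2, h3, hz⟩ := (sparkler_isContained_iff G).1 h
  have hp' := hp
  obtain ⟨e1, e2, e3, e4, -⟩ := hp'
  by_cases hx : G.Adj x p₂
  · refine .inr ?_
    by_contra hcon
    obtain ⟨hB, hC⟩ := not_or.1 hcon
    have hhom : ∀ y a b c d, G.Adj x y → G.Adj x a → G.Adj x b → G.Adj x c → G.Adj x d →
        [y, a, b, c, d].Nodup → G.Adj y a → G.Adj y b := by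
      intro y a b c d hy ha hb hc hd hn hya
      by_contra hyb
      exact hB ⟨x, ⟨p₁, p₂, p₃, p₄, hp⟩, y, hy,
        neighborsSplit_of_not_homogeneous ha hb hc hd hn hya hyb⟩
    simp only [List.nodup_cons, List.mem_cons, List.not_mem_nil, or_false, not_or,
      not_false_eq_true, List.nodup_nil, and_true] at hz hhom
    have k1 := hhom p₂ p₁ z₁ z₂ z₃ hx e1 h1 h2 h3 (by grind) e2.symm
    have k2 := hhom p₂ p₁ z₂ z₁ z₃ hx e1 h2 h1 h3 (by grind) e2.symm
    have k3 := hhom p₂ p₁ z₃ z₁ z₂ hx e1 h3 h1 h2 (by grind) e2.symm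
    have k4 := hhom p₁ p₂ z₁ z₂ z₃ e1 hx h1 h2 h3 (by grind) e2
    have k5 := hhom p₁ p₂ z₂ z₁ z₃ e1 hx h2 h1 h3 (by grind) e2
    have k6 := hhom p₁ p₂ z₃ z₁ z₂ e1 hx h3 h1 h2 (by grind) e2
    have k7 := hhom z₁ p₂ z₂ z₃ p₁ h1 hx h2 h3 e1 (by grind) k1.symm
    have k8 := hhom z₁ p₂ z₃ z₂ p₁ h1 hx h3 h2 e1 (by grind) k1.symm
    have k9 := hhom z₂ p₂ z₃ z₁ p₁ h2 hx h3 h1 e1 (by grind) k2.symm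
    exact hC ⟨p₁, p₂, z₁, z₂, z₃, e2, k4, k5, k6, k1, k2, k3, k7, k8, k9⟩
  · refine .inl ⟨x, ⟨p₁, z₁, z₂, z₃, e1, h1, h2, h3, ?_⟩, p₁, p₂, p₃, p₄, hp, hx⟩
    grind

/-! ### Distances and paths -/

/-- In a connected graph, the distance `d` to a nonempty vertex set `S`. -/
theorem exists_distance_function (hG : G.Connected) {S : Set V} (hS : S.Nonempty) :
    ∃ d : V → ℕ, (∀ v, d v = 0 ↔ v ∈ S) ∧ (∀ u v, G.Adj u v → d u ≤ d v + 1) ∧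
      ∀ v n, d v = n + 1 → ∃ w, G.Adj v w ∧ d w = n := by
  obtain ⟨s₀, hs₀⟩ := hS
  let D : V → Set ℕ := fun v => {n | ∃ s ∈ S, ∃ p : G.Walk v s, p.length = n}
  have hD : ∀ v, (D v).Nonempty := fun v => by
    obtain ⟨p⟩ := hG.preconnected v s₀
    exact ⟨p.length, s₀, hs₀, p, rfl⟩
  have hmem : ∀ v, sInf (D v) ∈ D v := fun v => Nat.sInf_mem (hD v)
  have hle : ∀ v n, n ∈ D v → sInf (D v) ≤ n := fun v n h => Nat.sInf_le h
  have hlip : ∀ u v, G.Adj u v → sInf (D u) ≤ sInf (D v) + 1 := by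
    intro u v h
    obtain ⟨s, hs, p, hp⟩ := hmem v
    exact hle _ _ ⟨s, hs, .cons h p, by rw [SimpleGraph.Walk.length_cons, hp]⟩
  refine ⟨fun v => sInf (D v), fun v => ⟨fun h => ?_, fun h => ?_⟩, hlip, fun v n h => ?_⟩
  · change sInf (D v) = 0 at h
    obtain ⟨s, hs, p, hp⟩ := hmem v
    rw [h] at hp
    rwa [SimpleGraph.Walk.eq_of_length_eq_zero hp]
  · exact Nat.le_zero.1 (hle _ _ ⟨v, h, .nil, rfl⟩)
  · change sInf (D v) = n + 1 at h
    obtain ⟨s, hs, p, hp⟩ := hmem v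
    rw [h] at hp
    cases p with
    | nil => simp at hp
    | @cons _ w _ hvw q =>
      have hq : q.length = n := by simpa using hp
      refine ⟨w, hvw, le_antisymm (hle _ _ ⟨s, hs, q, hq⟩) ?_⟩
      have := hlip _ _ hvw
      lia

/-- A vertex at distance at least two from a set `S` starts a path with four edges, provided
that each vertex of `S` starts a path with two edges inside `S`. -/
theorem exists_isPathFour_of_two_le {S : Set V} {d : V → ℕ} (h0 : ∀ v, d v = 0 ↔ v ∈ S)
    (hd : ∀ v n, d v = n + 1 → ∃ w, G.Adj v w ∧ d w = n)
    (hS : ∀ s ∈ S, ∃ t ∈ S, ∃ u ∈ S, G.Adj s t ∧ G.Adj t u ∧ s ≠ u) {y : V} (hy : 2 ≤ d y) :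
    ∃ p₁ p₂ p₃ p₄, IsPathFour G y p₁ p₂ p₃ p₄ := by
  obtain ⟨n, hn⟩ : ∃ n, d y = n + 1 + 1 := ⟨d y - 2, by lia⟩
  obtain ⟨a, hya, ha⟩ := hd _ _ hn
  obtain ⟨b, hab, hb⟩ := hd _ _ ha
  have hS' : ∀ s, d s = 0 → ∃ t, d t = 0 ∧ ∃ u, d u = 0 ∧ G.Adj s t ∧ G.Adj t u ∧ s ≠ u := by
    simpa only [h0] using hS
  clear hS h0
  rcases n with _ | n
  · obtain ⟨t, ht, u, hu, hbt, htu, hbu⟩ := hS' b hb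
    exact ⟨a, b, t, u, isPathFour_iff.2 ⟨⟨hya, hab, hbt, htu⟩, by grind⟩⟩
  · obtain ⟨c, hbc, hc⟩ := hd _ _ hb
    rcases n with _ | n
    · obtain ⟨t, ht, u, hu, hct, htu, hcu⟩ := hS' c hc
      exact ⟨a, b, c, t, isPathFour_iff.2 ⟨⟨hya, hab, hbc, hct⟩, by grind⟩⟩
    · obtain ⟨e, hce, he⟩ := hd _ _ hc
      exact ⟨a, b, c, e, isPathFour_iff.2 ⟨⟨hya, hab, hbc, hce⟩, by grind⟩⟩

end Graphs

section Finite

variable {V : Type} [Fintype V] {G : SimpleGraph V}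

open Classical in
theorem exists_adj_notMem (x : V) (s : Finset V) (h : s.card < G.degree x) :
    ∃ z, G.Adj x z ∧ z ∉ s := by
  obtain ⟨z, hz, hzs⟩ := Finset.exists_mem_notMem_of_card_lt_card
    (s := s) (t := G.neighborFinset x) (by rwa [G.card_neighborFinset_eq_degree])
  exact ⟨z, by simpa using hz, hzs⟩

open Classical in
theorem four_le_degree {x a b c d : V} (ha : G.Adj x a) (hb : G.Adj x b) (hc : G.Adj x c)
    (hd : G.Adj x d) (hn : [a, b, c, d].Nodup) : 4 ≤ G.degree x := by
  rw [← G.card_neighborFinset_eq_degree]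
  calc 4 = [a, b, c, d].toFinset.card := (List.toFinset_card_of_nodup hn).symm
    _ ≤ _ := Finset.card_le_card fun v hv => by
      simp only [List.mem_toFinset, List.mem_cons, List.not_mem_nil, or_false] at hv
      rcases hv with rfl | rfl | rfl | rfl <;> simpa

open Classical in
/-- A path with four edges extends to a sparkler if its start has three neighbours elsewhere;
this is counted using a set `s` that contains all neighbours of the start on the path. -/
theorem sparkler_isContained_of_isPathFour {x p₁ p₂ p₃ p₄ : V} (hp : IsPathFour G x p₁ p₂ p₃ p₄)
    (s : Finset V) (hs : ∀ v, G.Adj x v → v ∈ [p₁, p₂, p₃, p₄] → v ∈ s)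
    (hc : s.card + 3 ≤ G.degree x) : (sparkler 4 4).IsContained G := by
  obtain ⟨z₁, a₁, m₁⟩ := exists_adj_notMem (G := G) x s (by lia)
  obtain ⟨z₂, a₂, m₂⟩ := exists_adj_notMem (G := G) x (insert z₁ s)
    (by have := Finset.card_insert_le z₁ s; lia)
  obtain ⟨z₃, a₃, m₃⟩ := exists_adj_notMem (G := G) x (insert z₂ (insert z₁ s))
    (by have := Finset.card_insert_le z₁ s
        have := Finset.card_insert_le z₂ (insert z₁ s); lia)
  refine (sparkler_isContained_iff G).2 ⟨x, p₁, p₂, p₃, p₄, hp, z₁, z₂, z₃, a₁, a₂, a₃, ?_⟩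
  simp only [Finset.mem_insert, not_or] at m₂ m₃
  have k₁ := fun h => m₁ (hs _ a₁ h)
  have k₂ := fun h => m₂.2 (hs _ a₂ h)
  have k₃ := fun h => m₃.2.2 (hs _ a₃ h)
  have hn := hp.2.2.2.2
  simp only [List.nodup_cons, List.mem_cons, List.not_mem_nil, or_false, not_or,
    not_false_eq_true, List.nodup_nil, and_true] at *
  grind

open Classical in
/-- At most four of seven neighbours lie on the path. -/
theorem sparkler_isContained_of_seven_le_degree {x p₁ p₂ p₃ p₄ : V}
    (hp : IsPathFour G x p₁ p₂ p₃ p₄) (hx : 7 ≤ G.degree x) : (sparkler 4 4).IsContained G :=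
  sparkler_isContained_of_isPathFour hp [p₁, p₂, p₃, p₄].toFinset (fun v _ hv => by simpa using hv)
    (by have := List.toFinset_card_le [p₁, p₂, p₃, p₄]
        simp only [List.length_cons, List.length_nil] at this
        lia)

open Classical in
/-- A large connected graph with a vertex of degree at least four contains the sparkler, as the
star together with the start of a geodesic, unless some degree is at least seven. The bound `344`
is `7 ^ 3 + 1`: if all degrees are at most six, a ball of radius three has at most `7 ^ 3` vertices. -/
theorem sparkler_isContained_or_exists_seven_le_degree (hG : G.Connected)
    (hV : 344 ≤ Fintype.card V) {x : V} (hx : 4 ≤ G.degree x) :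
    (sparkler 4 4).IsContained G ∨ ∃ y, 7 ≤ G.degree y := by
  obtain ⟨d, h0, hlip, hd⟩ := exists_distance_function hG (Set.singleton_nonempty x)
  simp only [Set.mem_singleton_iff] at h0
  by_cases hfar : ∃ v, 4 ≤ d v
  · left
    obtain ⟨v, hv⟩ := hfar
    have hlevel : ∀ n v, d v = 4 + n → ∃ w, d w = 4 := by
      intro n
      induction n with
      | zero => exact fun v hv => ⟨v, hv⟩
      | succ n ih =>
        intro v hv
        obtain ⟨w, -, hw⟩ := hd v (4 + n) hv
        exact ih w hw
    obtain ⟨p₄, h₄⟩ := hlevel (d v - 4) v (by lia)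
    obtain ⟨p₃, e₄, h₃⟩ := hd _ _ h₄
    obtain ⟨p₂, e₃, h₂⟩ := hd _ _ h₃
    obtain ⟨p₁, e₂, h₁⟩ := hd _ _ h₂
    obtain ⟨x', e₁, hx'⟩ := hd _ _ h₁
    obtain rfl := (h0 x').1 hx'
    refine sparkler_isContained_of_isPathFour (x := x')
      (isPathFour_iff.2 ⟨⟨e₁.symm, e₂.symm, e₃.symm, e₄.symm⟩, by grind⟩) {p₁} ?_ (by simpa using hx)
    intro w hw hmem
    have := hlip w x' hw.symm
    simp only [List.mem_cons, List.not_mem_nil, or_false] at hmem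
    rcases hmem with rfl | rfl | rfl | rfl <;> first | lia | simp
  · right
    by_contra! hdeg
    push Not at hfar
    let B : ℕ → Finset V := fun n => {v | d v ≤ n}
    have hB : ∀ n, (B (n + 1)).card ≤ (B n).card * 7 := by
      intro n
      have hsub : B (n + 1) ⊆ (B n).biUnion fun v => insert v (G.neighborFinset v) := by
        intro v hv
        simp only [B, Finset.mem_filter, Finset.mem_univ, true_and, Finset.mem_biUnion,
          Finset.mem_insert, SimpleGraph.mem_neighborFinset] at hv ⊢
        by_cases hvn : d v ≤ n
        · exact ⟨v, hvn, .inl rfl⟩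
        · obtain ⟨w, hvw, hw⟩ := hd v n (by lia)
          exact ⟨w, hw.le, .inr hvw.symm⟩
      refine (Finset.card_le_card hsub).trans (Finset.card_biUnion_le_card_mul _ _ _ fun v _ => ?_)
      have := Finset.card_insert_le v (G.neighborFinset v)
      have := hdeg v
      rw [← G.card_neighborFinset_eq_degree] at this
      lia
    have hB0 : (B 0).card ≤ 1 := by
      refine Finset.card_le_one.2 fun a ha b hb => ?_
      simp only [B, Finset.mem_filter, Finset.mem_univ, true_and, Nat.le_zero, h0] at ha hb
      rw [ha, hb]
    have hB3 : (B 3).card = Fintype.card V := by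
      rw [← Finset.card_univ]
      congr 1
      ext v
      have := hfar v
      simp only [B, Finset.mem_filter, Finset.mem_univ, true_and, iff_true]
      lia
    have := hB 0
    have := hB 1
    have := hB 2
    simp only [zero_add, Nat.reduceAdd] at *
    lia

end Finite

/-! ### Large connected graphs satisfying the criterion contain the sparkler -/

section Sufficiency

variable {V : Type} [Fintype V] {G : SimpleGraph V}

open Classical in
/-- The case analysis behind the criterion: a path with four edges from a vertex `x` of degree at
least four, together with a vertex `y` of degree at least seven, yields a sparkler, unless
`x` has degree exactly four and is adjacent to the third vertex of the path. -/
theorem sparkler_isContained_of_isPathFour_of_seven_le_degree (hG : G.Connected)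
    {x p₁ p₂ p₃ p₄ y : V} (hp : IsPathFour G x p₁ p₂ p₃ p₄) (hx : 4 ≤ G.degree x)
    (hx' : ¬ G.Adj x p₂ ∨ 5 ≤ G.degree x) (hy : 7 ≤ G.degree y) :
    (sparkler 4 4).IsContained G := by
  by_contra hno
  -- A path with four edges from `y` would give a sparkler with centre `y`.
  have hP : ∀ {a b c d}, G.Adj y a → G.Adj a b → G.Adj b c → G.Adj c d →
      y ≠ b ∧ y ≠ c ∧ y ≠ d ∧ a ≠ c ∧ a ≠ d ∧ b ≠ d → False := fun h1 h2 h3 h4 h5 =>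
    hno (sparkler_isContained_of_seven_le_degree (isPathFour_iff.2 ⟨⟨h1, h2, h3, h4⟩, h5⟩) hy)
  obtain ⟨⟨e1, e2, e3, e4⟩, hn⟩ := isPathFour_iff.1 hp
  have hne := @SimpleGraph.Adj.ne _ G
  have n1 := hne e1
  have n2 := hne e2
  have n3 := hne e3
  have n4 := hne e4
  have havoid : ∀ a b c : V, ∃ z, G.Adj x z ∧ z ≠ a ∧ z ≠ b ∧ z ≠ c := by
    intro a b c
    obtain ⟨z, hz, hzs⟩ := exists_adj_notMem (G := G) x {a, b, c}
      (Finset.card_le_three.trans_lt hx)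
    exact ⟨z, hz, by simpa using hzs⟩
  -- The path itself does not extend to a sparkler with centre `x`, so it has a chord at `x`.
  have hchord : ¬ G.Adj x p₃ → ¬ G.Adj x p₄ → ¬ (¬ G.Adj x p₂ ∨ 5 ≤ G.degree x) := by
    intro h3 h4 h2
    rcases h2 with h2 | h2
    · refine hno (sparkler_isContained_of_isPathFour hp {p₁} ?_ (by simpa using hx))
      intro v hv hm
      simp only [List.mem_cons, List.not_mem_nil, or_false] at hm
      rcases hm with rfl | rfl | rfl | rfl <;> simp_all
    · refine hno (sparkler_isContained_of_isPathFour hp {p₁, p₂} ?_ ?_)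
      · intro v hv hm
        simp only [List.mem_cons, List.not_mem_nil, or_false] at hm
        rcases hm with rfl | rfl | rfl | rfl <;> simp_all
      · have := Finset.card_le_two (a := p₁) (b := p₂)
        lia
  obtain ⟨d, h0, -, hd⟩ := exists_distance_function hG
    (S := {v | v ∈ [x, p₁, p₂, p₃, p₄]}) ⟨x, by simp⟩
  have hdy : ¬ 2 ≤ d y := fun h => by
    obtain ⟨a, b, c, e, hq⟩ := exists_isPathFour_of_two_le h0 hd (by
      intro s hs
      simp only [List.mem_cons, List.not_mem_nil, or_false, Set.mem_ofPred_eq] at hs ⊢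
      rcases hs with rfl | rfl | rfl | rfl | rfl
      · exact ⟨p₁, by simp, p₂, by simp, e1, e2, by grind⟩
      · exact ⟨p₂, by simp, p₃, by simp, e2, e3, by grind⟩
      · exact ⟨p₃, by simp, p₄, by simp, e3, e4, by grind⟩
      · exact ⟨p₂, by simp, p₁, by simp, e3.symm, e2.symm, by grind⟩
      · exact ⟨p₃, by simp, p₂, by simp, e4.symm, e3.symm, by grind⟩) h
    exact hno (sparkler_isContained_of_seven_le_degree hq hy)
  by_cases hyS : d y = 0
  · have hmem := (h0 y).1 hyS
    simp only [List.mem_cons, List.not_mem_nil, or_false, Set.mem_ofPred_eq] at hmem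
    rcases hmem with rfl | rfl | rfl | rfl | rfl
    · exact hP e1 e2 e3 e4 hn
    · obtain ⟨z, hz, hz'⟩ := havoid y p₂ p₃
      refine hchord (fun h => ?_) (fun h => ?_) (.inl fun h => ?_)
      · exact hP e2 e3 h.symm hz (by grind)
      · exact hP e2 e3 e4 h.symm (by grind)
      · exact hP e1.symm h e3 e4 (by grind)
    · refine hchord (fun h => ?_) (fun h => ?_) hx'
      · exact hP e2.symm e1.symm h e4 (by grind)
      · exact hP e2.symm e1.symm h e4.symm (by grind)
    · obtain ⟨z, hz, hz'⟩ := havoid p₁ p₂ y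
      exact hP e3.symm e2.symm e1.symm hz (by grind)
    · exact hP e4.symm e3.symm e2.symm e1.symm (by grind)
  · have hyS' : y ∉ [x, p₁, p₂, p₃, p₄] := fun h => hyS ((h0 y).2 h)
    obtain ⟨w, hyw, hw⟩ := hd y 0 (by lia)
    have hmem := (h0 w).1 hw
    simp only [List.mem_cons, List.not_mem_nil, or_false, Set.mem_ofPred_eq, not_or] at hmem hyS'
    rcases hmem with rfl | rfl | rfl | rfl | rfl
    · exact hP hyw e1 e2 e3 (by grind)
    · exact hP hyw e2 e3 e4 (by grind)
    · obtain ⟨z, hz, hz'⟩ := havoid p₁ w y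
      exact hP hyw e2.symm e1.symm hz (by grind)
    · exact hP hyw e3.symm e2.symm e1.symm (by grind)
    · exact hP hyw e4.symm e3.symm e2.symm (by grind)

open Classical in
/-- From a vertex `y` in or attached to a clique of size five, a path with four edges runs through the
clique; if `y` is farther away, the way to the clique provides the first two edges. -/
theorem sparkler_isContained_of_clique (hG : G.Connected) {a b c d e y : V}
    (hab : G.Adj a b) (hac : G.Adj a c) (had : G.Adj a d) (hae : G.Adj a e) (hbc : G.Adj b c)
    (hbd : G.Adj b d) (hbe : G.Adj b e) (hcd : G.Adj c d) (hce : G.Adj c e) (hde : G.Adj d e)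
    (hy : 7 ≤ G.degree y) : (sparkler 4 4).IsContained G := by
  suffices h : ∃ p₁ p₂ p₃ p₄, IsPathFour G y p₁ p₂ p₃ p₄ by
    obtain ⟨p₁, p₂, p₃, p₄, h⟩ := h
    exact sparkler_isContained_of_seven_le_degree h hy
  let S : Finset V := {a, b, c, d, e}
  have hclique : ∀ u ∈ S, ∀ v ∈ S, u ≠ v → G.Adj u v := by
    have hsymm := @SimpleGraph.Adj.symm _ G
    simp only [S, Finset.mem_insert, Finset.mem_singleton]
    grind
  have hcard : 5 ≤ S.card := by
    have hne := @SimpleGraph.Adj.ne _ G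
    have hn : [a, b, c, d, e].Nodup := by
      simp [hne hab, hne hac, hne had, hne hae, hne hbc, hne hbd, hne hbe, hne hcd, hne hce,
        hne hde]
    have : S = [a, b, c, d, e].toFinset := by simp [S]
    rw [this, List.toFinset_card_of_nodup hn]
    simp
  have hnext : ∀ T : Finset V, T.card ≤ 4 → ∃ v ∈ S, v ∉ T := fun T hT =>
    Finset.exists_mem_notMem_of_card_lt_card (by lia)
  obtain ⟨δ, h0, -, hd⟩ := exists_distance_function hG (S := (S : Set V)) ⟨a, by simp [S]⟩
  by_cases h2 : 2 ≤ δ y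
  · refine exists_isPathFour_of_two_le h0 hd (fun s hs => ?_) h2
    obtain ⟨t, ht, hst⟩ := hnext {s} (by simp)
    obtain ⟨u, hu, hsu⟩ := hnext {s, t} (Finset.card_le_two.trans (by simp))
    simp only [Finset.mem_insert, Finset.mem_singleton, not_or] at hst hsu
    exact ⟨t, ht, u, hu, hclique s hs t ht (Ne.symm hst), hclique t ht u hu (Ne.symm hsu.2),
      Ne.symm hsu.1⟩
  · obtain ⟨p₁, m₁, q₁, hyp⟩ : ∃ p₁ ∈ S, p₁ ≠ y ∧ G.Adj y p₁ := by
      by_cases hy0 : δ y = 0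
      · obtain ⟨t, ht, hyt⟩ := hnext {y} (by simp)
        simp only [Finset.mem_singleton] at hyt
        exact ⟨t, ht, hyt, hclique y ((h0 y).1 hy0) t ht (Ne.symm hyt)⟩
      · obtain ⟨t, hyt, ht⟩ := hd y 0 (by lia)
        exact ⟨t, (h0 t).1 ht, hyt.ne', hyt⟩
    obtain ⟨p₂, m₂, q₂⟩ := hnext {y, p₁} (Finset.card_le_two.trans (by simp))
    obtain ⟨p₃, m₃, q₃⟩ := hnext {y, p₁, p₂} (Finset.card_le_three.trans (by simp))
    obtain ⟨p₄, m₄, q₄⟩ := hnext {y, p₁, p₂, p₃} Finset.card_le_four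
    simp only [Finset.mem_insert, Finset.mem_singleton, not_or] at q₂ q₃ q₄
    exact ⟨p₁, p₂, p₃, p₄, isPathFour_iff.2 ⟨⟨hyp, hclique _ m₁ _ m₂ (by grind),
      hclique _ m₂ _ m₃ (by grind), hclique _ m₃ _ m₄ (by grind)⟩, by grind⟩⟩

open Classical in
/-- Triples of neighbours of `x` with `j` and with `j + 1` neighbours of `y` provide `j + 1` vertices
adjacent to `y` and `3 - j` vertices not adjacent to `y`; the fifth neighbour of `x` is `y`. -/
theorem five_le_degree_of_neighborsSplit {x y : V} (hxy : G.Adj x y)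
    (h : (NeighborsSplit G x y false false false ∧ NeighborsSplit G x y true false false) ∨
      (NeighborsSplit G x y true false false ∧ NeighborsSplit G x y true true false) ∨
      (NeighborsSplit G x y true true false ∧ NeighborsSplit G x y true true true)) :
    5 ≤ G.degree x := by
  have key : ∀ l : List V, l.Nodup → (∀ v ∈ l, G.Adj x v) → l.length ≤ G.degree x := by
    intro l hl hadj
    rw [← List.toFinset_card_of_nodup hl, ← G.card_neighborFinset_eq_degree]
    exact Finset.card_le_card fun v hv => by
      simpa using hadj v (by simpa using hv)
  rcases h with ⟨⟨a, b, c, ha, hb, hc, hn, ka, kb, kc⟩, a', b', c', ha', hb', hc', hn', ka', kb', kc'⟩ |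
    ⟨⟨a, b, c, ha, hb, hc, hn, ka, kb, kc⟩, a', b', c', ha', hb', hc', hn', ka', kb', kc'⟩ |
    ⟨⟨a, b, c, ha, hb, hc, hn, ka, kb, kc⟩, a', b', c', ha', hb', hc', hn', ka', kb', kc'⟩ <;>
  simp only [List.nodup_cons, List.mem_cons, List.not_mem_nil, or_false, not_or,
      not_false_eq_true, List.nodup_nil, and_true, Bool.false_eq_true, iff_false, iff_true] at *
  · exact key [y, a, b, c, a'] (by simp; grind) (by simp [*])
  · exact key [y, b, c, a', b'] (by simp; grind) (by simp [*])
  · exact key [y, c, a', b', c'] (by simp; grind) (by simp [*])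

theorem sparkler_isContained_of_sparklerCriterion (hG : G.Connected) (hV : 344 ≤ Fintype.card V)
    (h : SparklerCriterion G) : (sparkler 4 4).IsContained G := by
  classical
  have large : ∀ x, 4 ≤ G.degree x → (∀ y, 7 ≤ G.degree y → (sparkler 4 4).IsContained G) →
      (sparkler 4 4).IsContained G := fun x hx hy =>
    (sparkler_isContained_or_exists_seven_le_degree hG hV hx).elim id fun ⟨y, h⟩ => hy y h
  rcases h with ⟨x, ⟨a, b, c, d, ha, hb, hc, hd, hn⟩, p₁, p₂, p₃, p₄, hp, hxp⟩ |
    ⟨x, ⟨p₁, p₂, p₃, p₄, hp⟩, y, hxy, h⟩ |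
    ⟨a, b, c, d, e, hab, hac, had, hae, hbc, hbd, hbe, hcd, hce, hde⟩
  · have hx := four_le_degree ha hb hc hd hn
    exact large x hx fun y hy =>
      sparkler_isContained_of_isPathFour_of_seven_le_degree hG hp hx (.inl hxp) hy
  · have hx := five_le_degree_of_neighborsSplit hxy h
    exact large x (by lia) fun y hy =>
      sparkler_isContained_of_isPathFour_of_seven_le_degree hG hp (by lia) (.inr hx) hy
  · refine large a (four_le_degree hab hac had hae ?_) fun y hy =>
      sparkler_isContained_of_clique hG hab hac had hae hbc hbd hbe hcd hce hde hy
    simp [hbc.ne, hbd.ne, hbe.ne, hcd.ne, hce.ne, hde.ne]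

end Sufficiency

theorem definesFrom_sparklerSentence :
    DefinesFrom (subgraphClass (sparkler 4 4)) 344 sparklerSentence := by
  intro V _ G hG hV
  have := Fintype.ofFinite V
  rw [Nat.card_eq_fintype_card] at hV
  rw [satisfies_sparklerSentence]
  exact ⟨sparkler_isContained_of_sparklerCriterion hG hV, sparklerCriterion_of_isContained⟩

theorem Dv_sparkler_le : Dv (sparkler 4 4) ≤ 5 := by
  refine iInf_le_of_le 344 (iInf₂_le_of_le sparklerSentence definesFrom_sparklerSentence ?_)
  rw [quantifierDepth_sparklerSentence]
  rfl

/-! ### The Ehrenfeucht–Fraïssé game -/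

section Game

variable {V W : Type} (G : SimpleGraph V) (H : SimpleGraph W)

/-- Finite tuples in two graphs define a partial isomorphism. -/
def IsPartialIso {n : ℕ} (xs : Fin n → V) (ys : Fin n → W) : Prop :=
  ∀ i j, (xs i = xs j ↔ ys i = ys j) ∧ (G.Adj (xs i) (xs j) ↔ H.Adj (ys i) (ys j))

/-- The Ehrenfeucht–Fraïssé argument: suppose `E` relates tuples of length at most `N` in two
graphs, implies partial isomorphism, and has the back-and-forth property for tuples of length less
than `N`. Then related tuples of length `n` satisfy the same formulas of quantifier depth at
most `N - n`. -/
theorem realize_iff_of_backAndForth {N : ℕ} (E : ∀ {n : ℕ}, (Fin n → V) → (Fin n → W) → Prop)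
    (hiso : ∀ {n} {xs : Fin n → V} {ys : Fin n → W}, E xs ys → IsPartialIso G H xs ys)
    (hforth : ∀ {n} {xs : Fin n → V} {ys : Fin n → W}, n < N → E xs ys → ∀ a, ∃ b,
      E (Fin.snoc (α := fun _ => V) xs a) (Fin.snoc (α := fun _ => W) ys b))
    (hback : ∀ {n} {xs : Fin n → V} {ys : Fin n → W}, n < N → E xs ys → ∀ b, ∃ a,
      E (Fin.snoc (α := fun _ => V) xs a) (Fin.snoc (α := fun _ => W) ys b))
    {n : ℕ} (φ : Language.graph.BoundedFormula Empty n) (hφ : n + quantifierDepth φ ≤ N)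
    {xs : Fin n → V} {ys : Fin n → W} (h : E xs ys) (v : Empty → V) (w : Empty → W) :
    @BoundedFormula.Realize _ V G.structure _ _ φ v xs ↔
      @BoundedFormula.Realize _ W H.structure _ _ φ w ys := by
  let := G.structure
  let := H.structure
  have hterm : ∀ {n : ℕ} (t : Language.graph.Term (Empty ⊕ Fin n)), ∃ i, t = &i := by
    intro n t
    rcases t with (e | i) | ⟨f, _⟩
    · exact e.elim
    · exact ⟨i, rfl⟩
    · exact isEmptyElim f
  induction φ with
  | falsum => rfl
  | equal t₁ t₂ =>
    obtain ⟨i, rfl⟩ := hterm t₁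
    obtain ⟨j, rfl⟩ := hterm t₂
    exact (hiso h i j).1
  | rel R ts =>
    cases R
    obtain ⟨i, hi⟩ := hterm (ts 0)
    obtain ⟨j, hj⟩ := hterm (ts 1)
    change G.Adj ((ts 0).realize _) ((ts 1).realize _) ↔ H.Adj ((ts 0).realize _) ((ts 1).realize _)
    rw [hi, hj]
    exact (hiso h i j).2
  | imp φ ψ ihφ ihψ =>
    have hd : _ + max (quantifierDepth φ) (quantifierDepth ψ) ≤ N := hφ
    exact imp_congr (ihφ (by lia) h) (ihψ (by lia) h)
  | @all n φ ih =>
    have hd : n + (quantifierDepth φ + 1) ≤ N := hφ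
    constructor
    · intro hall b
      obtain ⟨a, hab⟩ := hback (by lia) h b
      exact (ih (by lia) hab).1 (hall a)
    · intro hall a
      obtain ⟨b, hab⟩ := hforth (by lia) h a
      exact (ih (by lia) hab).2 (hall b)

end Game

/-! ### Two graphs that are indistinguishable at depth four -/

section Blowup

/-- The tree on six vertices with edges `01`, `12`, `23`, `34` and `25`. -/
def patternTree : SimpleGraph (Fin 6) :=
  SimpleGraph.fromRel fun i j => (i, j) ∈ [((0 : Fin 6), (1 : Fin 6)), (1, 2), (2, 3), (3, 4), (2, 5)]

instance : DecidableRel patternTree.Adj := fun a b =>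
  decidable_of_iff _ (SimpleGraph.fromRel_adj _ a b).symm

/-- The multiplicities of the vertices of `patternTree` in `blowup m n`. -/
def classSize (m n : ℕ) : Fin 6 → ℕ := ![1, m, 1, 1, 1, n]

/-- The blow-up of `patternTree` in which vertex `1` is replaced by `m` independent twins and
vertex `5` by `n` independent twins. The first component of a vertex is its class. -/
def blowup (m n : ℕ) : SimpleGraph (Σ c : Fin 6, Fin (classSize m n c)) :=
  patternTree.comap Sigma.fst

variable {m m' n : ℕ}

theorem patternTree_adj_cases : ∀ c d : Fin 6, patternTree.Adj c d →
    (c = 0 ∧ d = 1) ∨ (c = 1 ∧ (d = 0 ∨ d = 2)) ∨ (c = 2 ∧ (d = 1 ∨ d = 3 ∨ d = 5)) ∨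
      (c = 3 ∧ (d = 2 ∨ d = 4)) ∨ (c = 4 ∧ d = 3) ∨ (c = 5 ∧ d = 2) := by
  decide

theorem eq_of_class_eq {v w : Σ c : Fin 6, Fin (classSize m n c)} (h : v.1 = w.1) (h1 : v.1 ≠ 1)
    (h5 : v.1 ≠ 5) : v = w := by
  obtain ⟨c, i⟩ := v
  obtain ⟨c', j⟩ := w
  obtain rfl : c = c' := h
  have hsize : classSize m n c = 1 := by
    fin_cases c <;> simp_all [classSize]
  have hi := i.isLt
  have hj := j.isLt
  congr 1
  ext
  lia

theorem blowup_connected (hm : 0 < m) : (blowup m n).Connected := by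
  have hadj : ∀ c d i j, patternTree.Adj c d → (blowup m n).Reachable ⟨c, i⟩ ⟨d, j⟩ :=
    fun c d i j h => SimpleGraph.Adj.reachable (G := blowup m n) h
  have h1 : 0 < classSize m n 1 := hm
  have h2 : 0 < classSize m n 2 := Nat.one_pos
  have h3 : 0 < classSize m n 3 := Nat.one_pos
  refine (SimpleGraph.connected_iff_exists_forall_reachable _).2 ⟨⟨2, ⟨0, h2⟩⟩, ?_⟩
  rintro ⟨c, i⟩
  fin_cases c
  · exact (hadj 2 1 _ ⟨0, h1⟩ (by decide)).trans (hadj 1 0 _ _ (by decide))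
  · exact hadj 2 1 _ _ (by decide)
  · exact (hadj 2 1 _ ⟨0, h1⟩ (by decide)).trans (hadj 1 2 _ _ (by decide))
  · exact hadj 2 3 _ _ (by decide)
  · exact (hadj 2 3 _ ⟨0, h3⟩ (by decide)).trans (hadj 3 4 _ _ (by decide))
  · exact hadj 2 5 _ _ (by decide)

theorem le_card_blowup : n ≤ Nat.card (Σ c : Fin 6, Fin (classSize m n c)) := by
  have h := Nat.card_le_card_of_injective
    (fun j : Fin n => (⟨5, j⟩ : Σ c : Fin 6, Fin (classSize m n c))) fun i j hij =>
      eq_of_heq (Sigma.mk.inj hij).2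
  simpa using h

theorem sparkler_isContained_blowup (hm : 4 ≤ m) : (sparkler 4 4).IsContained (blowup m n) := by
  have hadj : ∀ c d i j, patternTree.Adj c d → (blowup m n).Adj ⟨c, i⟩ ⟨d, j⟩ :=
    fun c d i j h => h
  let u : ∀ i : ℕ, i < 4 → Fin (classSize m n 1) := fun i hi => ⟨i, lt_of_lt_of_le hi hm⟩
  have h₀ : 0 < 4 := by simp
  have h₁ : 1 < 4 := by simp
  have h₂ : 2 < 4 := by simp
  have h₃ : 3 < 4 := by simp
  have s₀ : 0 < classSize m n 0 := Nat.one_pos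
  have s₂ : 0 < classSize m n 2 := Nat.one_pos
  have s₃ : 0 < classSize m n 3 := Nat.one_pos
  have s₄ : 0 < classSize m n 4 := Nat.one_pos
  refine (sparkler_isContained_iff _).2 ⟨⟨0, ⟨0, s₀⟩⟩, ⟨1, u 0 h₀⟩, ⟨2, ⟨0, s₂⟩⟩, ⟨3, ⟨0, s₃⟩⟩,
    ⟨4, ⟨0, s₄⟩⟩, isPathFour_iff.2 ⟨⟨hadj _ _ _ _ (by decide), hadj _ _ _ _ (by decide),
      hadj _ _ _ _ (by decide), hadj _ _ _ _ (by decide)⟩, by simp⟩,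
    ⟨1, u 1 h₁⟩, ⟨1, u 2 h₂⟩, ⟨1, u 3 h₃⟩, hadj _ _ _ _ (by decide), hadj _ _ _ _ (by decide),
    hadj _ _ _ _ (by decide), by simp [u]⟩

theorem not_sparkler_isContained_blowup : ¬ (sparkler 4 4).IsContained (blowup 3 n) := by
  rw [sparkler_isContained_iff]
  rintro ⟨x, p₁, p₂, p₃, p₄, hp, z₁, z₂, z₃, h1, h2, h3, hz⟩
  obtain ⟨⟨e1, e2, e3, e4⟩, hn⟩ := isPathFour_iff.1 hp
  simp only [List.nodup_cons, List.mem_cons, List.not_mem_nil, or_false, not_or,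
    not_false_eq_true, List.nodup_nil, and_true] at hz
  have hc : ∀ {v w}, (blowup 3 n).Adj v w → _ := fun {v w} h => patternTree_adj_cases v.1 w.1 h
  have hs := @eq_of_class_eq 3 n
  -- Class `1` has only three vertices.
  have h4 : ¬ (z₁.1 = 1 ∧ z₂.1 = 1 ∧ z₃.1 = 1 ∧ p₁.1 = 1) := by
    obtain ⟨c₁, i₁⟩ := z₁
    obtain ⟨c₂, i₂⟩ := z₂
    obtain ⟨c₃, i₃⟩ := z₃
    obtain ⟨c₄, i₄⟩ := p₁
    rintro ⟨rfl, rfl, rfl, rfl⟩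
    have k₁ : i₁.val < 3 := i₁.isLt
    have k₂ : i₂.val < 3 := i₂.isLt
    have k₃ : i₃.val < 3 := i₃.isLt
    have k₄ : i₄.val < 3 := i₄.isLt
    simp only [Sigma.mk.injEq, heq_eq_eq, true_and, Fin.ext_iff] at hz
    lia
  have c1 := hc h1
  have c2 := hc h2
  have c3 := hc h3
  have d1 := hc e1
  have d2 := hc e2
  have d3 := hc e3
  have d4 := hc e4
  have n1 := @hs x p₂
  have n2 := @hs x p₄
  have n3 := @hs p₁ p₃
  have n4 := @hs p₂ p₄
  have n5 := @hs z₁ z₂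
  have n6 := @hs z₁ z₃
  have n7 := @hs z₂ z₃
  by_cases hx : x.1 = 2
  · have k1 : p₁.1 = 1 ∨ p₁.1 = 3 ∨ p₁.1 = 5 := by simpa [hx] using d1
    rcases k1 with k1 | k1 | k1
    · have k2 : p₂.1 = 0 ∨ p₂.1 = 2 := by simpa [k1] using d2
      rcases k2 with k2 | k2
      · have k3 : p₃.1 = 1 := by simpa [k2] using d3
        have k4 : p₄.1 = 0 ∨ p₄.1 = 2 := by simpa [k3] using d4
        rcases k4 with k4 | k4
        · exact hn.2.2.2.2.2 (n4 (k2.trans k4.symm) (by simp [k2]) (by simp [k2]))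
        · exact hn.2.2.1 (n2 (hx.trans k4.symm) (by simp [hx]) (by simp [hx]))
      · exact hn.1 (n1 (hx.trans k2.symm) (by simp [hx]) (by simp [hx]))
    · have k2 : p₂.1 = 2 ∨ p₂.1 = 4 := by simpa [k1] using d2
      rcases k2 with k2 | k2
      · exact hn.1 (n1 (hx.trans k2.symm) (by simp [hx]) (by simp [hx]))
      · have k3 : p₃.1 = 3 := by simpa [k2] using d3
        exact hn.2.2.2.1 (n3 (k1.trans k3.symm) (by simp [k1]) (by simp [k1]))
    · have k2 : p₂.1 = 2 := by simpa [k1] using d2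
      exact hn.1 (n1 (hx.trans k2.symm) (by simp [hx]) (by simp [hx]))
  · have hcount : (z₁.1 = 1 ∧ z₂.1 = 1 ∧ z₃.1 = 1 ∧ p₁.1 = 1) ∨ z₁ = z₂ ∨ z₁ = z₃ ∨ z₂ = z₃ := by
      clear hz h4 hn d2 d3 d4 n1 n2 n3 n4 hc hs h1 h2 h3 e1 e2 e3 e4 hp
      rcases c1 with ⟨k, l⟩ | ⟨k, l⟩ | ⟨k, l⟩ | ⟨k, l⟩ | ⟨k, l⟩ | ⟨k, l⟩ <;>
        simp [k] at c2 c3 d1 hx <;> grind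
    rcases hcount with h | h | h | h
    · exact h4 h
    · exact hz.1.1 h
    · exact hz.1.2.1 h
    · exact hz.2.1.1 h

theorem isPartialIso_snoc {V W : Type} {G : SimpleGraph V} {H : SimpleGraph W} {k : ℕ}
    {xs : Fin k → V} {ys : Fin k → W} (h : IsPartialIso G H xs ys) {a : V} {b : W}
    (heq : ∀ i, xs i = a ↔ ys i = b) (hadj : ∀ i, G.Adj (xs i) a ↔ H.Adj (ys i) b) :
    IsPartialIso G H (Fin.snoc (α := fun _ => V) xs a) (Fin.snoc (α := fun _ => W) ys b) := by
  intro i j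
  induction i using Fin.lastCases <;> induction j using Fin.lastCases <;>
    simp only [Fin.snoc_last, Fin.snoc_castSucc]
  · simp
  · rename_i j
    rw [eq_comm, heq j, eq_comm, G.adj_comm, hadj j, H.adj_comm]
    exact ⟨Iff.rfl, Iff.rfl⟩
  · exact ⟨heq _, hadj _⟩
  · exact h _ _

/-- The positions from which Duplicator survives: a partial isomorphism, which moreover preserves
classes as long as at most three vertices of each graph have been chosen. -/
def GoodPosition (m m' n : ℕ) {k : ℕ} (xs : Fin k → Σ c : Fin 6, Fin (classSize m n c))
    (ys : Fin k → Σ c : Fin 6, Fin (classSize m' n c)) : Prop :=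
  IsPartialIso (blowup m n) (blowup m' n) xs ys ∧ (k ≤ 3 → ∀ i, (xs i).1 = (ys i).1)

theorem GoodPosition.symm {k : ℕ} {xs : Fin k → Σ c : Fin 6, Fin (classSize m n c)}
    {ys : Fin k → Σ c : Fin 6, Fin (classSize m' n c)} (h : GoodPosition m m' n xs ys) :
    GoodPosition m' m n ys xs :=
  ⟨fun i j => ⟨(h.1 i j).1.symm, (h.1 i j).2.symm⟩, fun hk i => (h.2 hk i).symm⟩

/-- Duplicator's answer. It is taken in the same class as Spoiler's choice. The only obstacle is
that all of class `1` has been chosen already; then all three chosen vertices lie in this class, and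
the last answer can be any vertex of class `5`, which is not adjacent to them either. -/
theorem GoodPosition.forth (hm' : 3 ≤ m') (hn : 4 ≤ n) {k : ℕ} (hk : k < 4)
    {xs : Fin k → Σ c : Fin 6, Fin (classSize m n c)}
    {ys : Fin k → Σ c : Fin 6, Fin (classSize m' n c)} (h : GoodPosition m m' n xs ys)
    (a : Σ c : Fin 6, Fin (classSize m n c)) :
    ∃ b, GoodPosition m m' n (Fin.snoc (α := fun _ => Σ c : Fin 6, Fin (classSize m n c)) xs a)
      (Fin.snoc (α := fun _ => Σ c : Fin 6, Fin (classSize m' n c)) ys b) := by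
  obtain ⟨hiso, hcl⟩ := h
  replace hcl := hcl (by lia)
  -- It suffices to answer in the same class, preserving equality with earlier vertices.
  have same : ∀ b : Σ c : Fin 6, Fin (classSize m' n c), a.1 = b.1 →
      (∀ i, xs i = a ↔ ys i = b) → ∃ b, GoodPosition m m' n
        (Fin.snoc (α := fun _ => Σ c : Fin 6, Fin (classSize m n c)) xs a)
        (Fin.snoc (α := fun _ => Σ c : Fin 6, Fin (classSize m' n c)) ys b) := by
    intro b hab heq
    refine ⟨b, isPartialIso_snoc hiso heq fun i => ?_, fun _ i => ?_⟩
    · change patternTree.Adj (xs i).1 a.1 ↔ patternTree.Adj (ys i).1 b.1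
      rw [hcl i, hab]
    · induction i using Fin.lastCases with
      | last => simpa using hab
      | cast i => simpa using hcl i
  by_cases hold : ∃ i, xs i = a
  · obtain ⟨i, rfl⟩ := hold
    exact same (ys i) (hcl i) fun j => (hiso j i).1
  by_cases hfree : ∃ b : Σ c : Fin 6, Fin (classSize m' n c), a.1 = b.1 ∧ ∀ i, ys i ≠ b
  · obtain ⟨b, hab, hb⟩ := hfree
    exact same b hab fun i => ⟨fun h => (hold ⟨i, h⟩).elim, fun h => (hb i h).elim⟩
  push Not at hold hfree
  have hcover : ∀ j : Fin (classSize m' n a.1), ∃ i, ys i = ⟨a.1, j⟩ := fun j => hfree ⟨a.1, j⟩ rfl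
  choose f hf using hcover
  have hinj : Function.Injective f := fun i j hij => by
    have := (hf i).symm.trans ((congrArg ys hij).trans (hf j))
    simpa using this
  have hsize : classSize m' n a.1 ≤ k := by simpa using Fintype.card_le_of_injective f hinj
  have ha5 : a.1 ≠ 5 := fun h5 => by
    rw [h5] at hsize
    have : n ≤ k := hsize
    lia
  have ha1 : a.1 = 1 := by
    by_contra ha1
    -- Classes other than `1` and `5` have a single vertex, which would be `a`.
    have hpos : 0 < classSize m' n a.1 := by
      generalize a.1 = c at ha1 ha5
      fin_cases c <;> simp_all [classSize]
    refine hold (f ⟨0, hpos⟩) (eq_of_class_eq ?_ ?_ ?_)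
    all_goals rw [hcl, hf]
    · exact ha1
    · exact ha5
  have hk3 : k = 3 ∧ classSize m' n a.1 = k := by
    have : classSize m' n a.1 = m' := by rw [ha1]; rfl
    lia
  have hsurj : Function.Surjective f :=
    ((Fintype.bijective_iff_injective_and_card f).2 ⟨hinj, by simpa using hk3.2⟩).2
  have hys : ∀ i, (ys i).1 = 1 := fun i => by
    obtain ⟨j, rfl⟩ := hsurj i
    rw [hf, ha1]
  refine ⟨⟨5, ⟨0, lt_of_lt_of_le (by simp) hn⟩⟩, isPartialIso_snoc hiso (fun i => ?_) (fun i => ?_),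
    fun h => by lia⟩
  · refine ⟨fun h => (hold i h).elim, fun h => ?_⟩
    have := hys i
    rw [h] at this
    simp at this
  · change patternTree.Adj (xs i).1 a.1 ↔ patternTree.Adj (ys i).1 5
    rw [hcl i, hys i, ha1]
    decide

theorem satisfies_blowup_iff (hm : 3 ≤ m) (hm' : 3 ≤ m') (hn : 4 ≤ n)
    (φ : Language.graph.Sentence) (hφ : quantifierDepth φ ≤ 4) :
    Satisfies (blowup m n) φ ↔ Satisfies (blowup m' n) φ := by
  refine realize_iff_of_backAndForth (N := 4) _ _ (GoodPosition m m' n) (fun h => h.1)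
    (fun hk h a => h.forth hm' hn hk a) (fun hk h b => ?_) φ (by simpa using hφ)
    ⟨fun i => i.elim0, fun _ i => i.elim0⟩ _ _
  obtain ⟨a, ha⟩ := h.symm.forth hm hn hk b
  exact ⟨a, ha.symm⟩

end Blowup

theorem five_le_Dv_sparkler : 5 ≤ Dv (sparkler 4 4) := by
  refine le_iInf fun k => le_iInf₂ fun φ hφ => ?_
  by_contra hlt
  have hd : quantifierDepth φ ≤ 4 := by
    have : (quantifierDepth φ : ℕ∞) < (5 : ℕ) := not_le.1 hlt
    have := Nat.cast_lt.1 this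
    lia
  have hdef : ∀ m, 0 < m → (Satisfies (blowup m (k + 4)) φ ↔
      (sparkler 4 4).IsContained (blowup m (k + 4))) := fun m hm =>
    hφ _ _ (blowup_connected hm) (le_trans (by lia) le_card_blowup)
  have h := satisfies_blowup_iff (m := 4) (m' := 3) (n := k + 4) (by simp) le_rfl (by lia) φ hd
  rw [hdef 4 (by simp), hdef 3 (by simp)] at h
  exact not_sparkler_isContained_blowup (h.1 (sparkler_isContained_blowup le_rfl))

end GraphFO

theorem theorem3p1 :
    (∃ (W : Type) (_ : Finite W) (F : SimpleGraph W),
      F.Connected ∧ GraphFO.Dv F + 3 ≤ (Nat.card W : ℕ∞)) ∧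
    Nat.card (Fin 4 ⊕ Fin 4) = 8 ∧
    (GraphFO.sparkler 4 4).Connected ∧
    GraphFO.Dv (GraphFO.sparkler 4 4) = 5 := by
  have hcard : Nat.card (Fin 4 ⊕ Fin 4) = 8 := by simp
  have hDv : GraphFO.Dv (GraphFO.sparkler 4 4) = 5 :=
    le_antisymm GraphFO.Dv_sparkler_le GraphFO.five_le_Dv_sparkler
  refine ⟨⟨_, inferInstance, GraphFO.sparkler 4 4, GraphFO.sparkler_connected, ?_⟩, hcard,
    GraphFO.sparkler_connected, hDv⟩
  rw [hcard, hDv]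
  norm_num
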